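/- Let $\theta\in\mathbb R$ be irrational, and let $A_\theta$ be the universal C*-algebra generated by two unitaries $U,V$ with $UV=e^{2\pi i\theta}VU$. Let $\tau$ be its canonical (unique normalized) trace, so that $\tau(U^mV^n)=0$ for $(m,n)\neq(0,0)$ and $\tau(1)=1$, and put $\|a\|_2=\tau(a^*a)^{1/2}$. Let $A_\theta^\infty\subset A_\theta$ be the set of all sums $\sum_{(m,n)\in\mathbb Z^2}a_{m,n}U^mV^n$ whose coefficients are rapidly decreasing, that is, $\sup_{m,n}(1+m^2+n^2)^k|a_{m,n}|^2<\infty$ for every $k\in\mathbb N$. Let $s$ be a nonzero integer, and let $a=\sum_{n\in\mathbb Z}a_nU^nV^{sn}$ be an element of $A_\theta^\infty$ (so only monomials $U^mV^{m'}$ with $m'=sm$ occur) that is strictly positive, i.e. positive and invertible. Let $\log a$ be defined by the continuous functional calculus. Then $\tau(a^2\log a)$ is real, the series $\sum_{n}(1+|s|)|n||a_n|^2$ converges, and $$\tau(a^2\log a)\le\sum_{n\in\mathbb Z}(1+|s|)\,|n|\,|a_n|^2+\|a\|_2^2\log\|a\|_2 .$$ Equivalently, since $\|a\|_2^2=\tau(a^2)$,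 $$\tau(a^2\log a)\le\sum_{n\in\mathbb Z}(1+|s|)\,|n|\,|a_n|^2+\tau(a^2)\log\bigl(\tau(a^2)^{1/2}\bigr).$$ -/

import Mathlib

open scoped ENNReal

noncomputable section

namespace NCTorus

/-! ### The rotation algebra as a universal C*-algebra -/

/-- A pair of unitaries `u`, `v` in a nonzero unital C*-algebra satisfying
`u v = e^{2 π i θ} v u`.  A C*-algebra generated by two elements is separable, hence has a copy
in `Type`, so that all pairs of such unitaries are accounted for. -/
structure Rep (θ : ℝ) : Type 1 where
  carrier : Type
  [cstar : CStarAlgebra carrier]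
  [nontriv : Nontrivial carrier]
  u : unitary carrier
  v : unitary carrier
  comm_rel : (u * v : carrier) = Complex.exp (2 * Real.pi * Complex.I * θ) • (v * u : carrier)

attribute [instance] Rep.cstar Rep.nontriv

/-- The C*-algebra of bounded families of elements of the C*-algebras of all pairs in `Rep θ`,
with the supremum norm. -/
abbrev BigProduct (θ : ℝ) : Type 1 := lp (fun r : Rep θ => r.carrier) ∞

instance (θ : ℝ) : CStarAlgebra (BigProduct θ) where

theorem memℓp_of_unitary {θ : ℝ} (f : ∀ r : Rep θ, unitary r.carrier) :
    Memℓp (fun r : Rep θ => (f r : r.carrier)) ∞ :=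
  memℓp_infty ⟨1, by rintro _ ⟨r, rfl⟩; exact (CStarRing.norm_coe_unitary (f r)).le⟩

/-- A family of unitaries, as a unitary of the product. -/
def unitaryOfFamily {θ : ℝ} (f : ∀ r : Rep θ, unitary r.carrier) : unitary (BigProduct θ) :=
  ⟨⟨fun r => (f r : r.carrier), memℓp_of_unitary f⟩, by
    rw [Unitary.mem_iff]
    constructor
    · ext r
      exact Unitary.coe_star_mul_self (f r)
    · ext r
      exact Unitary.coe_mul_star_self (f r)⟩

/-- The closed *-subalgebra of the product generated by the families of all `u` and all `v`. -/
def rotationSubalgebra (θ : ℝ) : StarSubalgebra ℂ (BigProduct θ) :=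
  (StarAlgebra.adjoin ℂ ({(unitaryOfFamily (fun r : Rep θ => r.u) : BigProduct θ),
    (unitaryOfFamily (fun r : Rep θ => r.v) : BigProduct θ)} :
      Set (BigProduct θ))).topologicalClosure

instance (θ : ℝ) : IsClosed (rotationSubalgebra θ : Set (BigProduct θ)) :=
  StarSubalgebra.isClosed_topologicalClosure _

/-- The rotation algebra `A_θ`: the universal C*-algebra generated by two unitaries `U`, `V` with
`U V = e^{2 π i θ} V U`.  The norm of a *-polynomial in `U`, `V` is the supremum of the norms of
its values at all pairs of unitaries that satisfy the relation. -/
def RotationAlgebra (θ : ℝ) : Type 1 := rotationSubalgebra θ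

instance (θ : ℝ) : CStarAlgebra (RotationAlgebra θ) :=
  inferInstanceAs (CStarAlgebra (rotationSubalgebra θ))

/-- The usual order of a C*-algebra: `a ≤ b` iff `b - a` is self-adjoint with nonnegative
spectrum. -/
instance (θ : ℝ) : PartialOrder (RotationAlgebra θ) := CStarAlgebra.spectralOrder _

instance (θ : ℝ) : StarOrderedRing (RotationAlgebra θ) := CStarAlgebra.spectralOrderedRing _

/-- The family of all `u`, as an element of `A_θ`. -/
def genU (θ : ℝ) : RotationAlgebra θ :=
  (⟨(unitaryOfFamily (fun r : Rep θ => r.u) : BigProduct θ),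
    StarSubalgebra.le_topologicalClosure _ (by
      apply StarAlgebra.subset_adjoin ℂ
      simp)⟩ :
      rotationSubalgebra θ)

/-- The family of all `v`, as an element of `A_θ`. -/
def genV (θ : ℝ) : RotationAlgebra θ :=
  (⟨(unitaryOfFamily (fun r : Rep θ => r.v) : BigProduct θ),
    StarSubalgebra.le_topologicalClosure _ (by
      apply StarAlgebra.subset_adjoin ℂ
      simp)⟩ :
      rotationSubalgebra θ)

/-- The generator `U`. -/
def U (θ : ℝ) : unitary (RotationAlgebra θ) :=
  ⟨genU θ, Unitary.mem_iff.mpr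
    ⟨Subtype.ext (Unitary.coe_star_mul_self (unitaryOfFamily (fun r : Rep θ => r.u))),
      Subtype.ext (Unitary.coe_mul_star_self (unitaryOfFamily (fun r : Rep θ => r.u)))⟩⟩

/-- The generator `V`. -/
def V (θ : ℝ) : unitary (RotationAlgebra θ) :=
  ⟨genV θ, Unitary.mem_iff.mpr
    ⟨Subtype.ext (Unitary.coe_star_mul_self (unitaryOfFamily (fun r : Rep θ => r.v))),
      Subtype.ext (Unitary.coe_mul_star_self (unitaryOfFamily (fun r : Rep θ => r.v)))⟩⟩

theorem U_mul_V (θ : ℝ) : (U θ * V θ : RotationAlgebra θ) =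
    Complex.exp (2 * Real.pi * Complex.I * θ) • (V θ * U θ : RotationAlgebra θ) := by
  apply Subtype.ext
  ext r
  exact r.comm_rel

/-- The *-homomorphism from `A_θ` determined by a pair of unitaries satisfying the relation. -/
def lift {θ : ℝ} (r : Rep θ) : RotationAlgebra θ →⋆ₐ[ℂ] r.carrier where
  toFun a := (a : rotationSubalgebra θ).1 r
  map_one' := rfl
  map_mul' _ _ := rfl
  map_zero' := rfl
  map_add' _ _ := rfl
  commutes' _ := rfl
  map_star' _ := rfl

@[simp]
theorem lift_U {θ : ℝ} (r : Rep θ) : lift r (U θ : RotationAlgebra θ) = r.u := rfl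

@[simp]
theorem lift_V {θ : ℝ} (r : Rep θ) : lift r (V θ : RotationAlgebra θ) = r.v := rfl

theorem continuous_hom {θ : ℝ} {B : Type} [CStarAlgebra B] (φ : RotationAlgebra θ →⋆ₐ[ℂ] B) :
    Continuous φ :=
  AddMonoidHomClass.continuous_of_bound φ 1 fun a => by
    rw [one_mul]; exact NonUnitalStarAlgHom.norm_apply_le φ a

/-- The universal property of `A_θ`. -/
theorem existsUnique_lift {θ : ℝ} (r : Rep θ) : ∃! φ : RotationAlgebra θ →⋆ₐ[ℂ] r.carrier,
    φ (U θ : RotationAlgebra θ) = r.u ∧ φ (V θ : RotationAlgebra θ) = r.v := by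
  refine ⟨lift r, ⟨lift_U r, lift_V r⟩, fun ψ hψ => ?_⟩
  refine StarAlgHom.ext_topologicalClosure (R := ℂ) (A := BigProduct θ) (B := r.carrier)
    (φ := ψ) (ψ := lift r) (continuous_hom ψ) (continuous_hom (lift r)) ?_
  refine StarAlgHom.ext_adjoin (R := ℂ) (s := ({(unitaryOfFamily (fun r : Rep θ => r.u) :
    BigProduct θ), (unitaryOfFamily (fun r : Rep θ => r.v) : BigProduct θ)} :
      Set (BigProduct θ))) ?_
  rintro ⟨x, hx⟩ h
  rcases h with h | h
  · obtain rfl : x = _ := h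
    exact hψ.1
  · obtain rfl : x = _ := h
    exact hψ.2

/-! ### The canonical trace -/

/-- The Hilbert space `ℓ²(ℤ²)`. -/
abbrev L2Z2 : Type := lp (fun _ : ℤ × ℤ => ℂ) 2

theorem memℓp_weighted (σ : Equiv.Perm (ℤ × ℤ)) (w : ℤ × ℤ → Circle) (f : L2Z2) :
    Memℓp (fun p => (w p : ℂ) * f (σ p)) 2 := by
  have h := (lp.memℓp f).summable (by norm_num)
  apply memℓp_gen
  have hw : ∀ p, ‖(w p : ℂ) * f (σ p)‖ = ‖f (σ p)‖ := fun p => by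
    rw [norm_mul, Circle.norm_coe, one_mul]
  simp only [hw]
  exact (Equiv.summable_iff σ).mpr h

/-- The weighted permutation operator `(T f)(p) = w(p) f(σ⁻¹ p)` on `ℓ²(ℤ²)`. -/
def weightedShift (σ : Equiv.Perm (ℤ × ℤ)) (w : ℤ × ℤ → Circle) : L2Z2 ≃ₗᵢ[ℂ] L2Z2 where
  toFun f := ⟨fun p => (w p : ℂ) * f (σ.symm p), memℓp_weighted σ.symm w f⟩
  invFun f := ⟨fun p => ((w (σ p))⁻¹ : Circle) * f (σ p),
    memℓp_weighted σ (fun p => (w (σ p))⁻¹) f⟩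
  map_add' f g := lp.ext (funext fun p => mul_add _ _ _)
  map_smul' c f := lp.ext (funext fun p => mul_left_comm _ _ _)
  left_inv f := by ext p; simp
  right_inv f := by ext p; simp
  norm_map' f := by
    have h : ∀ g : L2Z2, ‖g‖ = (∑' p, ‖g p‖ ^ (2 : ℝ)) ^ (1 / 2 : ℝ) := fun g => by
      simpa using lp.norm_eq_tsum_rpow (p := 2) (by norm_num) g
    rw [h, h]
    congr 1
    have hw : ∀ p, ‖(w p : ℂ) * f (σ.symm p)‖ = ‖f (σ.symm p)‖ := fun p => by
      rw [norm_mul, Circle.norm_coe, one_mul]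
    calc ∑' p, ‖(w p : ℂ) * f (σ.symm p)‖ ^ (2 : ℝ) = ∑' p, ‖f (σ.symm p)‖ ^ (2 : ℝ) := by
          simp only [hw]
      _ = ∑' p, ‖f p‖ ^ (2 : ℝ) := Equiv.tsum_eq σ.symm (fun p => ‖f p‖ ^ (2 : ℝ))

/-- The operator `δ_{m,n} ↦ δ_{m+1,n}` on `ℓ²(ℤ²)`. -/
def regU : unitary (L2Z2 →L[ℂ] L2Z2) :=
  Unitary.linearIsometryEquiv.symm
    (weightedShift ((Equiv.addRight (1 : ℤ)).prodCongr (Equiv.refl ℤ)) (fun _ => 1))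

/-- The operator `δ_{m,n} ↦ e^{-2 π i m θ} δ_{m,n+1}` on `ℓ²(ℤ²)`. -/
def regV (θ : ℝ) : unitary (L2Z2 →L[ℂ] L2Z2) :=
  Unitary.linearIsometryEquiv.symm
    (weightedShift ((Equiv.refl ℤ).prodCongr (Equiv.addRight (1 : ℤ)))
      (fun p => Circle.exp (-(2 * Real.pi * p.1 * θ))))

theorem regU_apply (f : L2Z2) (p : ℤ × ℤ) :
    ((regU : L2Z2 →L[ℂ] L2Z2) f) p = f (p.1 - 1, p.2) := by
  change ((1 : Circle) : ℂ) * f (p.1 + -1, p.2) = _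
  simp [sub_eq_add_neg]

theorem regV_apply (θ : ℝ) (f : L2Z2) (p : ℤ × ℤ) :
    ((regV θ : L2Z2 →L[ℂ] L2Z2) f) p =
      Complex.exp (-(2 * Real.pi * p.1 * θ) * Complex.I) * f (p.1, p.2 - 1) := by
  change (Circle.exp (-(2 * Real.pi * p.1 * θ)) : ℂ) * f (p.1, p.2 + -1) = _
  rw [Circle.coe_exp, sub_eq_add_neg]
  push_cast
  rfl

instance : Nontrivial L2Z2 :=
  ⟨lp.single 2 0 1, 0, fun h => by simpa using congrArg (fun f : L2Z2 => f 0) h⟩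

/-- The pair of unitaries on `ℓ²(ℤ²)` given by the regular representation. -/
def regRep (θ : ℝ) : Rep θ where
  carrier := L2Z2 →L[ℂ] L2Z2
  u := regU
  v := regV θ
  comm_rel := by
    ext f p
    change ((regU : L2Z2 →L[ℂ] L2Z2) ((regV θ : L2Z2 →L[ℂ] L2Z2) f)) p =
      Complex.exp (2 * Real.pi * Complex.I * θ) *
        ((regV θ : L2Z2 →L[ℂ] L2Z2) ((regU : L2Z2 →L[ℂ] L2Z2) f)) p
    rw [regU_apply, regV_apply, regV_apply, regU_apply, ← mul_assoc, ← Complex.exp_add]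
    congr 2
    push_cast
    ring

/-- The regular representation of `A_θ`, as a *-homomorphism. -/
def regular (θ : ℝ) : RotationAlgebra θ →⋆ₐ[ℂ] (L2Z2 →L[ℂ] L2Z2) := lift (regRep θ)

/-- The canonical trace `τ(a) = ⟨δ₀, π(a) δ₀⟩`, where `π` is the regular representation. -/
def trace (θ : ℝ) : RotationAlgebra θ →ₗ[ℂ] ℂ where
  toFun a := inner ℂ (lp.single 2 0 1 : L2Z2)
    (regular θ a (lp.single 2 0 1))
  map_add' a b := by
    rw [map_add, ← inner_add_right]; rfl
  map_smul' c a := by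
    rw [map_smul, RingHom.id_apply, smul_eq_mul, ← inner_smul_right]; rfl

/-- `‖a‖₂ = τ(a* a)^{1/2}`. -/
def twoNorm {θ : ℝ} (a : RotationAlgebra θ) : ℝ := √(trace θ (star a * a)).re

/-! ### The smooth subalgebra -/

/-- The monomial `U^m V^n`. -/
def monomial (θ : ℝ) (m n : ℤ) : RotationAlgebra θ := (U θ ^ m * V θ ^ n : unitary _)

/-- Rapidly decreasing families of coefficients. -/
def RapidlyDecreasing (c : ℤ × ℤ → ℂ) : Prop :=
  ∀ k : ℕ, BddAbove (Set.range fun p : ℤ × ℤ =>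
    (1 + (p.1 : ℝ) ^ 2 + (p.2 : ℝ) ^ 2) ^ k * ‖c p‖ ^ 2)

/-- `A_θ^∞`: the sums `∑ a_{m,n} U^m V^n` with rapidly decreasing coefficients. -/
def smooth (θ : ℝ) : Set (RotationAlgebra θ) :=
  {a | ∃ c : ℤ × ℤ → ℂ, RapidlyDecreasing c ∧ HasSum (fun p => c p • monomial θ p.1 p.2) a}

/-- The canonical trace extracts the constant coefficient. -/
theorem trace_monomial (θ : ℝ) (m n : ℤ) :
    trace θ (monomial θ m n) = if m = 0 ∧ n = 0 then 1 else 0 := by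
  have key : regular θ (monomial θ m n) =
      ((regU ^ m * regV θ ^ n : unitary (L2Z2 →L[ℂ] L2Z2)) : L2Z2 →L[ℂ] L2Z2) := by
    have h := congrArg (Subtype.val)
      (map_mul (Unitary.map (StarMonoidHom.ofClass (regular θ))) (U θ ^ m) (V θ ^ n))
    rw [map_zpow, map_zpow] at h
    exact h
  have hV : ∀ (n : ℤ), ((regV θ ^ n : unitary (L2Z2 →L[ℂ] L2Z2)) : L2Z2 →L[ℂ] L2Z2)
      (lp.single 2 0 1) = lp.single 2 ((0, n) : ℤ × ℤ) (1 : ℂ) := by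
    have step : ∀ n : ℤ, (regV θ : L2Z2 →L[ℂ] L2Z2) (lp.single 2 ((0, n) : ℤ × ℤ) (1 : ℂ)) =
        lp.single 2 ((0, n + 1) : ℤ × ℤ) (1 : ℂ) := by
      intro n
      ext ⟨p, q⟩
      rw [regV_apply]
      by_cases hp : p = 0
      · subst hp
        simp [Pi.single_apply, sub_eq_iff_eq_add]
      · simp [lp.coeFn_single, hp]
    intro n
    induction n using Int.induction_on with
    | zero => rfl
    | succ k ih =>
      rw [add_comm, zpow_add, zpow_one, Submonoid.coe_mul, mul_apply_eq_comp, ih,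
        step, add_comm]
    | pred k ih =>
      have h2 := ih
      rw [show (-(k : ℤ)) = 1 + (-(k : ℤ) - 1) by ring, zpow_add, zpow_one, Submonoid.coe_mul,
        mul_apply_eq_comp, show 1 + (-(k : ℤ) - 1) = (-(k : ℤ) - 1) + 1 by ring,
        ← step] at h2
      exact (Unitary.linearIsometryEquiv (regV θ)).injective h2
  have hU : ∀ (m n : ℤ), ((regU ^ m : unitary (L2Z2 →L[ℂ] L2Z2)) : L2Z2 →L[ℂ] L2Z2)
      (lp.single 2 ((0, n) : ℤ × ℤ) (1 : ℂ)) = lp.single 2 ((m, n) : ℤ × ℤ) (1 : ℂ) := by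
    have step : ∀ m n : ℤ, (regU : L2Z2 →L[ℂ] L2Z2) (lp.single 2 ((m, n) : ℤ × ℤ) (1 : ℂ)) =
        lp.single 2 ((m + 1, n) : ℤ × ℤ) (1 : ℂ) := by
      intro m n
      ext ⟨p, q⟩
      rw [regU_apply]
      simp [Pi.single_apply, sub_eq_iff_eq_add]
    intro m n
    induction m using Int.induction_on with
    | zero => rfl
    | succ k ih =>
      rw [add_comm, zpow_add, zpow_one, Submonoid.coe_mul, mul_apply_eq_comp, ih,
        step, add_comm]
    | pred k ih =>
      have h2 := ih
      rw [show (-(k : ℤ)) = 1 + (-(k : ℤ) - 1) by ring, zpow_add, zpow_one, Submonoid.coe_mul,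
        mul_apply_eq_comp, show 1 + (-(k : ℤ) - 1) = (-(k : ℤ) - 1) + 1 by ring,
        ← step] at h2
      exact (Unitary.linearIsometryEquiv regU).injective h2
  change inner ℂ (lp.single 2 0 1 : L2Z2)
    (regular θ (monomial θ m n) (lp.single 2 0 1)) = _
  rw [key, Submonoid.coe_mul, mul_apply_eq_comp, hV, hU, lp.inner_single_left]
  simp [Pi.single_apply, Prod.ext_iff, eq_comm]

end NCTorus

end

/-! The entropy is controlled by the third moment. Put r = ‖a‖₂ and E = ∑ |n| |a_n|². For every l >
0, concavity of the logarithm gives x² log x ≤ x³/l + (log l - 1) x² on the spectrum. Apply the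
positive functional τ and choose l = r exp(2E/r²). The inequality with constant 2 then follows from
τ(a³) ≤ r³ exp(2E/r²), and 2 ≤ 1 + |s| because s is a nonzero integer.

To bound the third moment, split a = m + g with m = τ(a), and put x = ‖g‖₂². Then τ(g) = 0, m² + x =
r² and τ(a³) = m³ + 3mx + τ(g³). A product of three monomials has trace zero unless the exponents
add up to zero, and its trace has modulus at most 1. So |τ(g³)| is at most the commutative sum ∑ b_k
b_l b_{-k-l}, where b_n = |a_n| for n ≠ 0 and b_0 = 0 (`norm_trace_cube_le`); the phases coming from
θ and s play no role.

Among three nonzero integers with sum zero two have the same sign, so this sum is at most three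
times its part with kl > 0. There the arithmetic-geometric mean inequality separates b_{-k-l}² from
b_k² b_l². Since -n has |n| - 1 ordered decompositions into two integers of the same sign, the first
term sums to E - x, and the second to at most x² (`tsum_cubic_le`). The spectral gap x ≤ E and exp t
≥ 1 + t + t²/2 finish the estimate (`third_moment_le`). -/

/-! ### Cubic convolution sums on the integers. -/

/-- The number of ordered decompositions `-n = k + l` with `k`, `l` of the same sign. -/
theorem hasSum_ite_same_sign (n : ℤ) (hn : n ≠ 0) (y : ℝ) :
    HasSum (fun k : ℤ => if 0 < k * (-n - k) then y else 0) ((|(n : ℝ)| - 1) * y) := by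
  -- k and -n - k have the same sign exactly when k lies strictly between 0 and -n, which leaves |n|
  -- - 1 integers.
  have h := hasSum_sum_of_ne_finset_zero
    (f := fun k : ℤ => if 0 < k * (-n - k) then y else 0)
    (s := Finset.Ioo (min 0 (-n)) (max 0 (-n))) (L := SummationFilter.unconditional ℤ) (by
      intro k hk
      refine if_neg fun hpos => hk ?_
      rw [Finset.mem_Ioo]
      rcases mul_pos_iff.mp hpos with h | h <;> omega)
  convert h using 1
  rw [Finset.sum_congr rfl (g := fun _ => y), Finset.sum_const, Int.card_Ioo, nsmul_eq_mul]
  · congr 1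
    rw [← Int.cast_natCast (R := ℝ), ← Int.cast_abs]
    norm_cast
    rcases abs_cases n with ⟨h, _⟩ | ⟨h, _⟩ <;> omega
  · intro k hk
    rw [Finset.mem_Ioo] at hk
    refine if_pos (mul_pos_iff.mpr ?_)
    omega

/-- The substitution `(k, l) ↦ (l, -k - l)` of pairs of integers, which permutes cyclically the
triples of integers with sum zero. -/
def rotateTriple : ℤ × ℤ ≃ ℤ × ℤ where
  toFun p := (p.2, -p.1 - p.2)
  invFun p := (-p.1 - p.2, p.1)
  left_inv p := by ext <;> dsimp only; ring
  right_inv p := by ext <;> dsimp only; ring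

theorem rotateTriple_apply (p : ℤ × ℤ) : rotateTriple p = (p.2, -p.1 - p.2) := rfl

theorem rotateTriple_rotateTriple_apply (p : ℤ × ℤ) :
    rotateTriple (rotateTriple p) = (-p.1 - p.2, p.1) :=
  Prod.ext rfl (show -p.2 - (-p.1 - p.2) = p.1 by ring)

/-- Of three nonzero integers with sum zero, two have the same sign; so a cyclically invariant sum
is controlled by the part where the first two have the same sign. -/
theorem tsum_le_three_mul_tsum_same_sign {F : ℤ × ℤ → ℝ} (hF0 : ∀ p, 0 ≤ F p) (hFs : Summable F)
    (hrot : ∀ p, F (rotateTriple p) = F p)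
    (hz : ∀ p : ℤ × ℤ, p.1 = 0 ∨ p.2 = 0 ∨ -p.1 - p.2 = 0 → F p = 0) :
    ∑' p, F p ≤ 3 * ∑' p : ℤ × ℤ, if 0 < p.1 * p.2 then F p else 0 := by
  obtain ⟨G, hG⟩ : ∃ G : ℤ × ℤ → ℝ, ∀ p, G p = if 0 < p.1 * p.2 then F p else 0 :=
    ⟨_, fun _ => rfl⟩
  simp only [← hG]
  have hGs : Summable G :=
    Summable.of_nonneg_of_le (fun p => by rw [hG]; split_ifs; exacts [hF0 p, le_rfl])
      (fun p => by rw [hG]; split_ifs; exacts [le_rfl, hF0 p]) hFs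
  have hGr : ∀ e : ℤ × ℤ ≃ ℤ × ℤ, HasSum (fun p => G (e p)) (∑' p, G p) := fun e =>
    (Equiv.hasSum_iff e).mpr hGs.hasSum
  -- Off the zero set of `F`, at least one of the three rotations of p lies in the region where `G`
  -- equals `F`, and `F` is constant on the orbit.
  have hle : ∀ p, F p ≤ G p + G (rotateTriple p) + G ((rotateTriple.trans rotateTriple) p) := by
    intro p
    have h0 := hF0 p
    have h1 := hrot p
    have h2 := hrot (rotateTriple p)
    rw [h1] at h2
    rw [rotateTriple_rotateTriple_apply] at h2
    rw [rotateTriple_apply] at h1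
    rw [Equiv.trans_apply, rotateTriple_rotateTriple_apply, rotateTriple_apply, hG, hG, hG, h1, h2]
    by_cases h : p.1 = 0 ∨ p.2 = 0 ∨ -p.1 - p.2 = 0
    · simp [hz p h]
    · have h3 : 0 < p.1 * p.2 ∨ 0 < p.2 * (-p.1 - p.2) ∨ 0 < (-p.1 - p.2) * p.1 := by
        simp only [mul_pos_iff]; omega
      rcases h3 with h | h | h <;> simp only [h, if_true] <;> split_ifs <;> linarith
  have h := hasSum_le hle hFs.hasSum
    ((hGs.hasSum.add (hGr rotateTriple)).add (hGr (rotateTriple.trans rotateTriple)))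
  linarith

/-- Group the pairs by n = -k - l: each b_n² is counted once per same-sign decomposition of -n, that
is |n| - 1 times. The condition b_0 = 0 matters because this formula gives -1 at n = 0, where the
true count is 0. -/
theorem hasSum_same_sign_sq {b : ℤ → ℝ} (hb0 : b 0 = 0) (hsq : Summable fun n => b n ^ 2)
    (hs2 : Summable fun n : ℤ => |(n : ℝ)| * b n ^ 2) :
    HasSum (fun p : ℤ × ℤ => if 0 < p.1 * p.2 then b (-p.1 - p.2) ^ 2 else 0)
      (∑' n : ℤ, |(n : ℝ)| * b n ^ 2 - ∑' n, b n ^ 2) := by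
  -- The same sum in the coordinates (n, k), reached from (k, l) by two rotations, so that the
  -- fibres over n are the sets of decompositions of -n.
  obtain ⟨J, hJ⟩ : ∃ J : ℤ × ℤ → ℝ, ∀ p, J p = if 0 < p.2 * (-p.1 - p.2) then b p.1 ^ 2 else 0 :=
    ⟨_, fun _ => rfl⟩
  have hJfib : ∀ n : ℤ, HasSum (fun k => J (n, k)) ((|(n : ℝ)| - 1) * b n ^ 2) := by
    intro n
    simp only [hJ]
    by_cases hn : n = 0
    · subst hn; simp [hb0, hasSum_zero]
    · exact hasSum_ite_same_sign n hn _
  have hdiff : HasSum (fun n : ℤ => (|(n : ℝ)| - 1) * b n ^ 2)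
      (∑' n : ℤ, |(n : ℝ)| * b n ^ 2 - ∑' n, b n ^ 2) := by
    simpa only [sub_mul, one_mul] using hs2.hasSum.sub hsq.hasSum
  have hJs : Summable J := by
    refine (summable_prod_of_nonneg fun p => ?_).mpr ⟨fun n => (hJfib n).summable, ?_⟩
    · rw [hJ, Pi.zero_apply]; split_ifs; exacts [sq_nonneg _, le_rfl]
    · simpa only [(hJfib _).tsum_eq] using hdiff.summable
  have hJsum : HasSum J (∑' n : ℤ, |(n : ℝ)| * b n ^ 2 - ∑' n, b n ^ 2) := by
    have h := hJs.hasSum.prod_fiberwise hJfib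
    rw [← h.unique hdiff]; exact hJs.hasSum
  have h := (Equiv.hasSum_iff (rotateTriple.trans rotateTriple)).mpr hJsum
  refine h.congr_fun fun p => ?_
  rw [Function.comp_apply, Equiv.trans_apply, rotateTriple_rotateTriple_apply, hJ]
  dsimp only
  rw [show -(-p.1 - p.2) - p.1 = p.2 by ring]

/-- A bound for the cubic form `∑ b k * b l * b (-k - l)` by the weighted `ℓ²` norm of order
`1 / 2`. -/
theorem tsum_cubic_le {b : ℤ → ℝ} (hb : ∀ n, 0 ≤ b n) (hb0 : b 0 = 0) (hs : Summable b)
    (hsq : Summable fun n => b n ^ 2)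
    (hs2 : Summable fun n : ℤ => |(n : ℝ)| * b n ^ 2) {μ : ℝ} (hμ : 0 < μ) :
    ∑' p : ℤ × ℤ, b p.1 * b p.2 * b (-p.1 - p.2) ≤
      3 * (μ / 2 * (∑' n : ℤ, |(n : ℝ)| * b n ^ 2 - ∑' n, b n ^ 2) +
        (∑' n, b n ^ 2) ^ 2 / (2 * μ)) := by
  have hF0 : ∀ p : ℤ × ℤ, 0 ≤ b p.1 * b p.2 * b (-p.1 - p.2) := fun p =>
    mul_nonneg (mul_nonneg (hb _) (hb _)) (hb _)
  -- The third factor is at most ∑ b, which leaves a product of two summable families.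
  have hFs : Summable fun p : ℤ × ℤ => b p.1 * b p.2 * b (-p.1 - p.2) :=
    Summable.of_nonneg_of_le hF0
      (fun p => mul_le_mul_of_nonneg_left (hs.le_tsum _ fun i _ => hb i)
        (mul_nonneg (hb _) (hb _)))
      ((hs.mul_of_nonneg hs hb hb).mul_right (∑' i, b i))
  have h1 := tsum_le_three_mul_tsum_same_sign hF0 hFs
    (fun p => by
      simp only [rotateTriple_apply]
      rw [show -p.2 - (-p.1 - p.2) = p.1 by ring]; ring)
    (fun p h => by rcases h with h | h | h <;> simp [h, hb0])
  have hprod : HasSum (fun p : ℤ × ℤ => b p.1 ^ 2 * b p.2 ^ 2) ((∑' n, b n ^ 2) ^ 2) := by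
    rw [pow_two (∑' n, b n ^ 2)]
    exact hsq.hasSum.mul hsq.hasSum
      (hsq.mul_of_nonneg hsq (fun n => sq_nonneg _) (fun n => sq_nonneg _))
  have hR := ((hasSum_same_sign_sq hb0 hsq hs2).mul_left (μ / 2)).add (hprod.div_const (2 * μ))
  have hGs : Summable fun p : ℤ × ℤ =>
      if 0 < p.1 * p.2 then b p.1 * b p.2 * b (-p.1 - p.2) else 0 :=
    Summable.of_nonneg_of_le (fun p => by split_ifs; exacts [hF0 p, le_rfl])
      (fun p => by split_ifs; exacts [le_rfl, hF0 p]) hFs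
  have h2 := hasSum_le (fun p => ?_) hGs.hasSum hR
  · linarith
  · split_ifs with h
    · have : 0 ≤ (μ * b (-p.1 - p.2) - b p.1 * b p.2) ^ 2 / (2 * μ) := by positivity
      have h2 : (μ * b (-p.1 - p.2) - b p.1 * b p.2) ^ 2 / (2 * μ) =
          μ / 2 * b (-p.1 - p.2) ^ 2 + b p.1 ^ 2 * b p.2 ^ 2 / (2 * μ) -
            b p.1 * b p.2 * b (-p.1 - p.2) := by
        field_simp; ring
      linarith
    · positivity

/-! ### The scalar inequality for the third moment. -/

/-- The optimization of the bounds for the third moment. -/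
theorem third_moment_le {r m x e t : ℝ} (hr : 0 < r) (hx : 0 ≤ x) (hxe : x ≤ e)
    (hrmx : m ^ 2 + x = r ^ 2)
    (ht : t ≤ 3 * ((4 / 3 * r) / 2 * (e - x) + x ^ 2 / (2 * (4 / 3 * r)))) :
    m ^ 3 + 3 * m * x + t ≤ r ^ 3 * Real.exp (2 * e / r ^ 2) := by
  -- Compare squares, with m² = r² - x: the coefficient 3/2 is the one that cancels the terms in r⁴
  -- x.
  have h1 : m * (r ^ 2 + 2 * x) ≤ r ^ 3 + 3 / 2 * (x * r) := by
    refine abs_le_of_sq_le_sq' ?_ (by positivity) |>.2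
    have h : (r ^ 3 + 3 / 2 * (x * r)) ^ 2 - (m * (r ^ 2 + 2 * x)) ^ 2 =
        9 / 4 * (x ^ 2 * r ^ 2) + 4 * x ^ 3 := by
      rw [mul_pow, show m ^ 2 = r ^ 2 - x by linarith]; ring
    have : 0 ≤ 9 / 4 * (x ^ 2 * r ^ 2) + 4 * x ^ 3 := by positivity
    linarith
  have h2 : m ^ 3 + 3 * m * x = m * (r ^ 2 + 2 * x) := by rw [← hrmx]; ring
  have h3 : 1 + 2 * e / r ^ 2 + (2 * e / r ^ 2) ^ 2 / 2 ≤ Real.exp (2 * e / r ^ 2) :=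
    Real.quadratic_le_exp_of_nonneg (div_nonneg (by linarith) (by positivity))
  have h4 := mul_le_mul_of_nonneg_left h3 (pow_nonneg hr.le 3)
  have h5 : r ^ 3 * (1 + 2 * e / r ^ 2 + (2 * e / r ^ 2) ^ 2 / 2) =
      r ^ 3 + 2 * e * r + 2 * e ^ 2 / r := by field_simp
  -- The weight 4/3 r turns the coefficient of e into 2r, exactly the linear term 2er of the
  -- exponential expansion.
  have h6 : 3 * ((4 / 3 * r) / 2 * (e - x) + x ^ 2 / (2 * (4 / 3 * r))) =
      2 * r * (e - x) + 9 / 8 * x ^ 2 / r := by field_simp; ring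
  -- The quadratic term of the exponential absorbs this one, since 0 ≤ x ≤ e.
  have h7 : 9 / 8 * x ^ 2 / r ≤ 2 * e ^ 2 / r := by
    gcongr
    nlinarith
  -- The remaining linear terms in x add up to (3/2 - 2) x r ≤ 0.
  have h8 : 0 ≤ x * r := by positivity
  rw [h5] at h4
  rw [h6] at ht
  nlinarith

/-! ### Monomials as translations of the standard basis up to phases. -/

noncomputable section

namespace NCTorus

/-- The standard basis vector of `ℓ²(ℤ²)`. -/
def delta (p : ℤ × ℤ) : L2Z2 := lp.single 2 p 1

theorem delta_apply (p q : ℤ × ℤ) : delta p q = if q = p then 1 else 0 := by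
  rw [delta, lp.single_apply, Pi.single_apply]

theorem inner_delta (p : ℤ × ℤ) (f : L2Z2) : inner ℂ (delta p) f = f p := by
  rw [delta, lp.inner_single_left]; simp

/-- Operators on `ℓ²(ℤ²)` that translate the standard basis by `q`, up to phases. -/
def IsPhaseShift (T : L2Z2 →L[ℂ] L2Z2) (q : ℤ × ℤ) : Prop :=
  ∀ p, ∃ z : ℂ, ‖z‖ = 1 ∧ T (delta p) = z • delta (p + q)

theorem IsPhaseShift.one : IsPhaseShift 1 0 := fun p => ⟨1, norm_one, by simp⟩

theorem IsPhaseShift.mul {S T : L2Z2 →L[ℂ] L2Z2} {q r : ℤ × ℤ} (hS : IsPhaseShift S q)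
    (hT : IsPhaseShift T r) : IsPhaseShift (S * T) (q + r) := by
  intro p
  obtain ⟨z, hz, h⟩ := hT p
  obtain ⟨w, hw, h'⟩ := hS (p + r)
  refine ⟨z * w, by rw [norm_mul, hz, hw, one_mul], ?_⟩
  rw [mul_apply_eq_comp, h, map_smul, h', smul_smul, add_assoc, add_comm r q]

theorem IsPhaseShift.inv {T : unitary (L2Z2 →L[ℂ] L2Z2)} {q : ℤ × ℤ}
    (hT : IsPhaseShift (T : L2Z2 →L[ℂ] L2Z2) q) :
    IsPhaseShift ((T⁻¹ : unitary _) : L2Z2 →L[ℂ] L2Z2) (-q) := by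
  intro p
  obtain ⟨z, hz, h⟩ := hT (p + -q)
  have hz0 : z ≠ 0 := norm_ne_zero_iff.mp (by rw [hz]; exact one_ne_zero)
  refine ⟨z⁻¹, by rw [norm_inv, hz, inv_one], ?_⟩
  rw [neg_add_cancel_right] at h
  have h2 : ((T⁻¹ : unitary _) : L2Z2 →L[ℂ] L2Z2) ((T : L2Z2 →L[ℂ] L2Z2) (delta (p + -q))) =
      delta (p + -q) := by
    rw [← mul_apply_eq_comp, ← Submonoid.coe_mul, inv_mul_cancel]; rfl
  rw [h, map_smul] at h2
  rw [← h2, smul_smul, inv_mul_cancel₀ hz0, one_smul]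

theorem IsPhaseShift.zpow {T : unitary (L2Z2 →L[ℂ] L2Z2)} {q : ℤ × ℤ}
    (hT : IsPhaseShift (T : L2Z2 →L[ℂ] L2Z2) q) (n : ℤ) :
    IsPhaseShift ((T ^ n : unitary _) : L2Z2 →L[ℂ] L2Z2) (n • q) := by
  have hpow : ∀ k : ℕ, IsPhaseShift ((T ^ k : unitary _) : L2Z2 →L[ℂ] L2Z2) (k • q) := by
    intro k
    induction k with
    | zero => simpa using IsPhaseShift.one
    | succ k ih =>
      rw [pow_succ, succ_nsmul, Submonoid.coe_mul]
      exact ih.mul hT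
  obtain ⟨k, rfl | rfl⟩ := n.eq_nat_or_neg
  · simpa using hpow k
  · simpa using (hpow k).inv

theorem isPhaseShift_regU : IsPhaseShift (regU : L2Z2 →L[ℂ] L2Z2) (1, 0) := by
  rintro ⟨m, n⟩
  refine ⟨1, norm_one, ?_⟩
  ext ⟨k, l⟩
  rw [regU_apply, one_smul, delta_apply, delta_apply]
  simp [sub_eq_iff_eq_add]

theorem isPhaseShift_regV (θ : ℝ) : IsPhaseShift (regV θ : L2Z2 →L[ℂ] L2Z2) (0, 1) := by
  rintro ⟨m, n⟩
  refine ⟨Complex.exp (-(2 * Real.pi * m * θ) * Complex.I), ?_, ?_⟩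
  · have := Complex.norm_exp_ofReal_mul_I (-(2 * Real.pi * m * θ))
    push_cast at this
    exact this
  · ext ⟨k, l⟩
    rw [regV_apply, lp.coeFn_smul, Pi.smul_apply, smul_eq_mul, delta_apply, delta_apply]
    by_cases hk : k = m
    · simp [hk, sub_eq_iff_eq_add]
    · simp [hk]

theorem regular_monomial (θ : ℝ) (m n : ℤ) : regular θ (monomial θ m n) =
    ((regU ^ m * regV θ ^ n : unitary (L2Z2 →L[ℂ] L2Z2)) : L2Z2 →L[ℂ] L2Z2) := by
  have h := congrArg (Subtype.val)
    (map_mul (Unitary.map (StarMonoidHom.ofClass (regular θ))) (U θ ^ m) (V θ ^ n))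
  rw [map_zpow, map_zpow] at h
  exact h

theorem isPhaseShift_regular_monomial (θ : ℝ) (m n : ℤ) :
    IsPhaseShift (regular θ (monomial θ m n)) (m, n) := by
  rw [regular_monomial, Submonoid.coe_mul]
  simpa using (isPhaseShift_regU.zpow m).mul ((isPhaseShift_regV θ).zpow n)

/-! ### The trace as a vector state -/

theorem trace_apply {θ : ℝ} (a : RotationAlgebra θ) :
    trace θ a = inner ℂ (delta 0) (regular θ a (delta 0)) := rfl

/-- The canonical trace, as a continuous linear functional. -/
def traceCLM (θ : ℝ) : RotationAlgebra θ →L[ℂ] ℂ where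
  toLinearMap := trace θ
  cont := by
    have : Continuous (regular θ) := continuous_hom (B := L2Z2 →L[ℂ] L2Z2) (lift (regRep θ))
    change Continuous fun a => inner ℂ (delta 0) (regular θ a (delta 0))
    fun_prop

theorem traceCLM_apply {θ : ℝ} (a : RotationAlgebra θ) : traceCLM θ a = trace θ a := rfl

/-- The vector of a C*-algebra element in the GNS space of the trace. -/
def gnsVector (θ : ℝ) : RotationAlgebra θ →L[ℂ] L2Z2 where
  toFun a := regular θ a (delta 0)
  map_add' a b := by rw [map_add]; rfl
  map_smul' c a := by rw [map_smul]; rfl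
  cont := by
    have : Continuous (regular θ) := continuous_hom (B := L2Z2 →L[ℂ] L2Z2) (lift (regRep θ))
    fun_prop

/-- This identifies the GNS space of the trace: δ₀ is the vector that represents it, so ‖a‖₂ is the
ℓ² norm of π(a) δ₀. -/
theorem trace_star_mul {θ : ℝ} (a b : RotationAlgebra θ) :
    trace θ (star a * b) = inner ℂ (gnsVector θ a) (gnsVector θ b) := by
  rw [trace_apply, map_mul, map_star, mul_apply_eq_comp, ContinuousLinearMap.star_eq_adjoint,
    ContinuousLinearMap.adjoint_inner_right]
  rfl

theorem trace_star_mul_self {θ : ℝ} (a : RotationAlgebra θ) :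
    trace θ (star a * a) = ((‖gnsVector θ a‖ ^ 2 : ℝ) : ℂ) := by
  rw [trace_star_mul, inner_self_eq_norm_sq_to_K]; push_cast; rfl

theorem trace_star {θ : ℝ} (a : RotationAlgebra θ) :
    trace θ (star a) = star (trace θ a) := by
  have h1 := trace_star_mul a 1
  have h2 := trace_star_mul 1 a
  rw [mul_one] at h1
  rw [star_one, one_mul] at h2
  rw [h1, h2, ← inner_conj_symm]; rfl

theorem trace_im_of_isSelfAdjoint {θ : ℝ} {a : RotationAlgebra θ} (ha : IsSelfAdjoint a) :
    (trace θ a).im = 0 := by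
  have h := trace_star a
  rw [ha.star_eq] at h
  exact Complex.conj_eq_iff_im.mp h.symm

theorem trace_re_nonneg {θ : ℝ} {a : RotationAlgebra θ} (ha : 0 ≤ a) : 0 ≤ (trace θ a).re := by
  obtain ⟨b, rfl⟩ := CStarAlgebra.nonneg_iff_eq_star_mul_self.mp ha
  rw [trace_star_mul_self, Complex.ofReal_re]
  positivity

theorem trace_re_mono {θ : ℝ} {a b : RotationAlgebra θ} (h : a ≤ b) :
    (trace θ a).re ≤ (trace θ b).re := by
  have := trace_re_nonneg (sub_nonneg.mpr h)
  rw [map_sub, Complex.sub_re] at this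
  linarith

theorem monomial_zero (θ : ℝ) : monomial θ 0 0 = 1 := by simp [monomial]

theorem trace_one (θ : ℝ) : trace θ 1 = 1 := by
  simpa [monomial_zero] using trace_monomial θ 0 0

instance (θ : ℝ) : Nontrivial (RotationAlgebra θ) :=
  ⟨1, 0, fun h => by simpa [trace_one] using congrArg (trace θ) h⟩

theorem norm_monomial (θ : ℝ) (m n : ℤ) : ‖monomial θ m n‖ = 1 :=
  CStarRing.norm_coe_unitary _

theorem exists_gnsVector_monomial (θ : ℝ) (p : ℤ × ℤ) :
    ∃ z : ℂ, ‖z‖ = 1 ∧ gnsVector θ (monomial θ p.1 p.2) = z • delta p := by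
  obtain ⟨z, hz, h⟩ := isPhaseShift_regular_monomial θ p.1 p.2 0
  rw [zero_add] at h
  exact ⟨z, hz, h⟩

/-- The product sends δ₀ to a unimodular multiple of the basis vector at p + q + r, and the trace
reads off the coordinate at 0. Only the modulus is kept, so the commutation phases disappear. -/
theorem norm_trace_monomial_mul_mul_le (θ : ℝ) (p q r : ℤ × ℤ) :
    ‖trace θ (monomial θ p.1 p.2 * monomial θ q.1 q.2 * monomial θ r.1 r.2)‖ ≤
      if p + q + r = 0 then 1 else 0 := by
  obtain ⟨z, hz, h⟩ := (((isPhaseShift_regular_monomial θ p.1 p.2).mul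
    (isPhaseShift_regular_monomial θ q.1 q.2)).mul (isPhaseShift_regular_monomial θ r.1 r.2)) 0
  rw [trace_apply, map_mul, map_mul, h, inner_delta, lp.coeFn_smul, Pi.smul_apply, smul_eq_mul,
    delta_apply, norm_mul, hz, one_mul, zero_add]
  change ‖if 0 = p + q + r then (1 : ℂ) else 0‖ ≤ _
  by_cases h0 : p + q + r = 0
  · simp [h0]
  · simp [h0, Ne.symm h0]

end NCTorus
end

/-! ### Coefficients, Parseval's identity and summability along a line. -/

noncomputable section

namespace NCTorus

/-- The coefficients of the GNS vector of `∑ c i U^{(f i).1} V^{(f i).2}`. -/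
theorem gnsVector_apply_of_hasSum {θ : ℝ} {ι : Type*} {f : ι → ℤ × ℤ}
    {c : ι → ℂ} {a : RotationAlgebra θ}
    (h : HasSum (fun i => c i • monomial θ (f i).1 (f i).2) a) {z : ℤ × ℤ → ℂ}
    (hz : ∀ p, gnsVector θ (monomial θ p.1 p.2) = z p • delta p) (p : ℤ × ℤ) :
    HasSum (fun i => if p = f i then c i * z p else 0) (gnsVector θ a p) := by
  have h1 := ((lp.evalCLM ℂ (fun _ : ℤ × ℤ => ℂ) 2 p).comp (gnsVector θ)).hasSum h
  refine h1.congr_fun fun i => ?_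
  change _ = (gnsVector θ (c i • monomial θ (f i).1 (f i).2)) p
  rw [map_smul, hz, lp.coeFn_smul, Pi.smul_apply, lp.coeFn_smul, Pi.smul_apply, delta_apply]
  split_ifs with h <;> simp [h]

/-- Distinct monomials send δ₀ to multiples of distinct basis vectors, so one coordinate sees one
coefficient, up to a phase. In particular the moduli of the coefficients are determined by a. -/
theorem norm_gnsVector_apply {θ : ℝ} {ι : Type*} {f : ι → ℤ × ℤ} (hf : Function.Injective f)
    {c : ι → ℂ} {a : RotationAlgebra θ}
    (h : HasSum (fun i => c i • monomial θ (f i).1 (f i).2) a) (i : ι) :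
    ‖gnsVector θ a (f i)‖ = ‖c i‖ := by
  choose z hz1 hz using exists_gnsVector_monomial θ
  have h1 := (gnsVector_apply_of_hasSum h hz (f i)).unique (hasSum_single i fun j hj =>
    if_neg fun hij => hj (hf hij).symm)
  rw [h1, if_pos rfl, norm_mul, hz1, mul_one]

theorem gnsVector_apply_of_notMem_range {θ : ℝ} {ι : Type*} {f : ι → ℤ × ℤ}
    {c : ι → ℂ} {a : RotationAlgebra θ}
    (h : HasSum (fun i => c i • monomial θ (f i).1 (f i).2) a) {p : ℤ × ℤ}
    (hp : p ∉ Set.range f) : gnsVector θ a p = 0 := by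
  choose z hz1 hz using exists_gnsVector_monomial θ
  refine (gnsVector_apply_of_hasSum h hz p).unique ?_
  convert hasSum_zero with i
  exact if_neg fun hi => hp ⟨i, hi.symm⟩

/-- Parseval's identity. -/
theorem hasSum_norm_sq_coeff {θ : ℝ} {ι : Type*} {f : ι → ℤ × ℤ} (hf : Function.Injective f)
    {c : ι → ℂ} {a : RotationAlgebra θ}
    (h : HasSum (fun i => c i • monomial θ (f i).1 (f i).2) a) :
    HasSum (fun i => ‖c i‖ ^ 2) (‖gnsVector θ a‖ ^ 2) := by
  have h1 := lp.hasSum_norm (p := 2) (by norm_num) (gnsVector θ a)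
  simp only [ENNReal.toReal_ofNat, Real.rpow_ofNat] at h1
  have h2 := (hf.hasSum_iff fun p hp => by
    rw [gnsVector_apply_of_notMem_range h hp]; simp).mpr h1
  refine h2.congr_fun fun i => ?_
  rw [Function.comp_apply, norm_gnsVector_apply hf h]

theorem injective_line (s : ℤ) : Function.Injective fun n : ℤ => ((n, s * n) : ℤ × ℤ) :=
  fun _ _ h => congrArg Prod.fst h

/-- Rapid decrease bounds the coefficients along a line of monomials. -/
theorem exists_norm_coeff_le {θ : ℝ} {a : RotationAlgebra θ} (ha : a ∈ smooth θ) {s : ℤ}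
    {c : ℤ → ℂ} (hac : HasSum (fun n : ℤ => c n • monomial θ n (s * n)) a) :
    ∃ C : ℝ, ∀ n : ℤ, (1 + (n : ℝ) ^ 2) ^ 2 * ‖c n‖ ^ 2 ≤ C := by
  obtain ⟨d, hd, hda⟩ := ha
  obtain ⟨C, hC⟩ := hd 2
  refine ⟨C, fun n => ?_⟩
  have h1 : ‖c n‖ = ‖d (n, s * n)‖ := by
    rw [← norm_gnsVector_apply (injective_line s) hac n]
    -- Rapid decrease is known for an expansion over ℤ² that is given separately from the one along
    -- the line; both have the same moduli because they share a GNS vector.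
    exact norm_gnsVector_apply (f := id) Function.injective_id hda (n, s * n)
  rw [h1]
  refine le_trans ?_ (hC ⟨(n, s * n), rfl⟩)
  dsimp only
  refine mul_le_mul_of_nonneg_right (pow_le_pow_left₀ (by positivity) ?_ 2) (sq_nonneg _)
  linarith [sq_nonneg ((s * n : ℤ) : ℝ)]

theorem summable_inv_one_add_sq : Summable fun n : ℤ => (1 + (n : ℝ) ^ 2)⁻¹ := by
  have h : Summable fun n : ℤ => 1 / (n : ℝ) ^ 2 :=
    Real.summable_one_div_int_pow.mpr one_lt_two
  refine Summable.of_norm_bounded_eventually h ?_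
  -- The comparison fails at n = 0, where 1 / 0² is 0 by convention.
  filter_upwards [(Set.finite_singleton (0 : ℤ)).compl_mem_cofinite] with n hn
  have hn' : 0 < (n : ℝ) ^ 2 := by
    have : (n : ℝ) ≠ 0 := Int.cast_ne_zero.mpr hn
    positivity
  rw [Real.norm_of_nonneg (by positivity), one_div]
  gcongr
  linarith

theorem summable_norm_of_bound {c : ℤ → ℂ} {C : ℝ}
    (hC : ∀ n : ℤ, (1 + (n : ℝ) ^ 2) ^ 2 * ‖c n‖ ^ 2 ≤ C) : Summable fun n => ‖c n‖ := by
  refine Summable.of_nonneg_of_le (fun n => norm_nonneg _) (fun n => ?_)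
    (summable_inv_one_add_sq.mul_left √C)
  have h : (1 + (n : ℝ) ^ 2) * ‖c n‖ ≤ √C := Real.le_sqrt_of_sq_le (by rw [mul_pow]; exact hC n)
  have h0 : 0 < 1 + (n : ℝ) ^ 2 := by positivity
  rw [← div_eq_mul_inv, le_div_iff₀ h0]
  linarith

theorem summable_abs_mul_norm_sq_of_bound {c : ℤ → ℂ} {C : ℝ}
    (hC : ∀ n : ℤ, (1 + (n : ℝ) ^ 2) ^ 2 * ‖c n‖ ^ 2 ≤ C) :
    Summable fun n : ℤ => |(n : ℝ)| * ‖c n‖ ^ 2 := by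
  refine Summable.of_nonneg_of_le (fun n => by positivity) (fun n => ?_)
    (summable_inv_one_add_sq.mul_left C)
  have h0 : 0 < 1 + (n : ℝ) ^ 2 := by positivity
  rw [← div_eq_mul_inv, le_div_iff₀ h0]
  refine le_trans ?_ (hC n)
  have h1 : |(n : ℝ)| ≤ 1 + (n : ℝ) ^ 2 := by
    rw [← sq_abs]; nlinarith [sq_nonneg (|(n : ℝ)| - 1), abs_nonneg (n : ℝ)]
  have h2 := mul_le_mul_of_nonneg_right h1
    (by positivity : 0 ≤ (1 + (n : ℝ) ^ 2) * ‖c n‖ ^ 2)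
  nlinarith

/-! ### The third moment as a sum over triples. -/

theorem hasSum_ite_sum_eq_zero {G : (ℤ × ℤ) × ℤ → ℝ} {S : ℝ}
    (h : HasSum (fun p : ℤ × ℤ => G (p, -p.1 - p.2)) S) :
    HasSum (fun q : (ℤ × ℤ) × ℤ => if q.1.1 + q.1.2 + q.2 = 0 then G q else 0) S := by
  have hi : Function.Injective fun p : ℤ × ℤ => ((p, -p.1 - p.2) : (ℤ × ℤ) × ℤ) :=
    fun p p' h => (Prod.ext_iff.mp h).1
  rw [← hi.hasSum_iff]
  · refine h.congr_fun fun p => ?_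
    rw [Function.comp_apply, if_pos]
    dsimp only
    ring
  · rintro ⟨p, k⟩ hq
    refine if_neg fun h0 => hq ⟨p, Prod.ext rfl ?_⟩
    dsimp only at h0 ⊢
    linarith

theorem hasSum_mul_of_summable_norm {R ι κ : Type*} [NormedRing R] [CompleteSpace R]
    {u : ι → R} {v : κ → R} {a b : R} (h : HasSum u a) (h' : HasSum v b)
    (hu : Summable fun i => ‖u i‖) (hv : Summable fun i => ‖v i‖) :
    HasSum (fun p : ι × κ => u p.1 * v p.2) (a * b) :=
  h.mul h' (summable_mul_of_summable_norm hu hv)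

theorem hasSum_mul_mul_self {R ι : Type*} [NormedRing R] [CompleteSpace R] {u : ι → R} {a : R}
    (h : HasSum u a) (hu : Summable fun i => ‖u i‖) :
    HasSum (fun q : (ι × ι) × ι => u q.1.1 * u q.1.2 * u q.2) (a * a * a) := by
  have h2 : HasSum (fun p : ι × ι => u p.1 * u p.2) (a * a) :=
    hasSum_mul_of_summable_norm h h hu hu
  have hu2 : Summable fun p : ι × ι => ‖u p.1 * u p.2‖ := Summable.mul_norm hu hu
  exact hasSum_mul_of_summable_norm (u := fun p : ι × ι => u p.1 * u p.2) (v := u) h2 h hu2 hu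

/-- Only the first coordinates are tested. This weaker condition keeps the upper bound valid, and
for points (n, sn) of the line it is equivalent to p + q + r = 0. -/
theorem norm_trace_smul_monomial_mul_mul_le (θ : ℝ) (x y z : ℂ) (p q r : ℤ × ℤ) :
    ‖trace θ (x • monomial θ p.1 p.2 * y • monomial θ q.1 q.2 * z • monomial θ r.1 r.2)‖ ≤
      if p.1 + q.1 + r.1 = 0 then ‖x‖ * ‖y‖ * ‖z‖ else 0 := by
  rw [smul_mul_smul_comm, smul_mul_smul_comm, map_smul, norm_smul, norm_mul, norm_mul]
  have h0 : 0 ≤ ‖x‖ * ‖y‖ * ‖z‖ := by positivity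
  refine (mul_le_mul_of_nonneg_left (norm_trace_monomial_mul_mul_le θ p q r) h0).trans ?_
  by_cases h : p + q + r = 0
  · rw [if_pos h, if_pos (show p.1 + q.1 + r.1 = 0 from congrArg Prod.fst h), mul_one]
  · rw [if_neg h, mul_zero]
    split_ifs
    exacts [h0, le_rfl]

/-- The third moment is bounded by the cubic form of the moduli of the coefficients. -/
theorem norm_trace_cube_le {θ : ℝ} {s : ℤ} {c : ℤ → ℂ} {a : RotationAlgebra θ}
    (h : HasSum (fun n : ℤ => c n • monomial θ n (s * n)) a) (hc : Summable fun n => ‖c n‖) :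
    ‖trace θ (a * a * a)‖ ≤ ∑' p : ℤ × ℤ, ‖c p.1‖ * ‖c p.2‖ * ‖c (-p.1 - p.2)‖ := by
  have hn : Summable fun n : ℤ => ‖c n • monomial θ n (s * n)‖ := by
    simpa only [norm_smul, norm_monomial, mul_one] using hc
  have h4 := (traceCLM θ).hasSum (hasSum_mul_mul_self h hn)
  have hB : Summable fun p : ℤ × ℤ => ‖c p.1‖ * ‖c p.2‖ * ‖c (-p.1 - p.2)‖ :=
    Summable.of_nonneg_of_le
      (fun p => mul_nonneg (mul_nonneg (norm_nonneg _) (norm_nonneg _)) (norm_nonneg _))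
      (fun p => mul_le_mul_of_nonneg_left (hc.le_tsum (-p.1 - p.2) fun i _ => norm_nonneg _)
        (mul_nonneg (norm_nonneg _) (norm_nonneg _)))
      ((hc.mul_of_nonneg hc (fun _ => norm_nonneg _) fun _ => norm_nonneg _).mul_right
        (∑' i, ‖c i‖))
  have h5 := hasSum_ite_sum_eq_zero (G := fun q => ‖c q.1.1‖ * ‖c q.1.2‖ * ‖c q.2‖) hB.hasSum
  rw [← traceCLM_apply, ← h4.tsum_eq]
  exact tsum_of_norm_bounded h5 fun q => norm_trace_smul_monomial_mul_mul_le θ _ _ _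
    (q.1.1, s * q.1.1) (q.1.2, s * q.1.2) (q.2, s * q.2)

/-! ### Entropy, tangent lines and the logarithmic Sobolev inequality. -/

/-- Strict positivity keeps the spectrum away from 0, where the logarithm is discontinuous. As a
single functional calculus the product is visibly self-adjoint and can be compared pointwise on the
spectrum. -/
theorem sq_mul_log_eq_cfc {θ : ℝ} {a : RotationAlgebra θ} (ha : IsStrictlyPositive a) :
    a ^ 2 * CFC.log a = cfc (fun x : ℝ => x ^ 2 * Real.log x) a := by
  have hsa : IsSelfAdjoint a := ha.isSelfAdjoint
  have hlog : ContinuousOn Real.log (spectrum ℝ a) :=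
    Real.continuousOn_log.mono fun x hx => (ha.spectrum_pos hx).ne'
  rw [cfc_mul (fun x : ℝ => x ^ 2) Real.log a (by fun_prop) hlog, cfc_pow_id a 2]
  rfl

/-- The tangent line of the logarithm at `l` bounds the entropy by moments. -/
theorem trace_sq_mul_log_le {θ : ℝ} {a : RotationAlgebra θ} (ha : IsStrictlyPositive a) {l : ℝ}
    (hl : 0 < l) : (trace θ (a ^ 2 * CFC.log a)).re ≤
      l⁻¹ * (trace θ (a ^ 3)).re + (Real.log l - 1) * (trace θ (a ^ 2)).re := by
  have hsa : IsSelfAdjoint a := ha.isSelfAdjoint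
  have hlog : ContinuousOn (fun x : ℝ => x ^ 2 * Real.log x) (spectrum ℝ a) :=
    (continuousOn_id.pow 2).mul
      (Real.continuousOn_log.mono fun x hx => (ha.spectrum_pos hx).ne')
  have h1 : cfc (fun x : ℝ => x ^ 2 * Real.log x) a ≤
      cfc (fun x : ℝ => l⁻¹ * x ^ 3 + (Real.log l - 1) * x ^ 2) a := by
    refine cfc_mono (fun x hx => ?_) hlog (by fun_prop)
    have hx0 : 0 < x := ha.spectrum_pos hx
    -- The inequality log t ≤ t - 1 at t = x / l, to be multiplied by x².
    have h2 := Real.log_le_sub_one_of_pos (div_pos hx0 hl)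
    rw [Real.log_div hx0.ne' hl.ne'] at h2
    have h3 := mul_le_mul_of_nonneg_left h2 (sq_nonneg x)
    have h4 : l⁻¹ * x ^ 3 = x ^ 2 * (x / l) := by ring
    rw [h4]
    linarith
  have h2 : cfc (fun x : ℝ => l⁻¹ * x ^ 3 + (Real.log l - 1) * x ^ 2) a =
      ((l⁻¹ : ℝ) : ℂ) • a ^ 3 + ((Real.log l - 1 : ℝ) : ℂ) • a ^ 2 := by
    rw [cfc_add a (fun x : ℝ => l⁻¹ * x ^ 3) (fun x : ℝ => (Real.log l - 1) * x ^ 2),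
      cfc_const_mul _ (fun x : ℝ => x ^ 3) a, cfc_const_mul _ (fun x : ℝ => x ^ 2) a,
      cfc_pow_id a 2, cfc_pow_id a 3]
    rfl
  rw [h2, ← sq_mul_log_eq_cfc ha] at h1
  have h3 := trace_re_mono h1
  rwa [map_add, map_smul, map_smul, Complex.add_re, smul_eq_mul, smul_eq_mul, Complex.re_ofReal_mul,
    Complex.re_ofReal_mul] at h3

/-- The logarithmic Sobolev inequality with constant `2` along a line of monomials. -/
theorem trace_sq_mul_log_le_energy {θ : ℝ} {s : ℤ} {a : RotationAlgebra θ} {c : ℤ → ℂ}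
    (hac : HasSum (fun n : ℤ => c n • monomial θ n (s * n)) a) (hc : Summable fun n => ‖c n‖)
    (hc2 : Summable fun n : ℤ => |(n : ℝ)| * ‖c n‖ ^ 2) (hpos : IsStrictlyPositive a) :
    (trace θ (a ^ 2 * CFC.log a)).re ≤ 2 * ∑' n : ℤ, |(n : ℝ)| * ‖c n‖ ^ 2 +
      ‖gnsVector θ a‖ ^ 2 * Real.log ‖gnsVector θ a‖ := by
  have hsa : IsSelfAdjoint a := hpos.isSelfAdjoint
  have hN := hasSum_norm_sq_coeff (injective_line s) hac
  set r := ‖gnsVector θ a‖ with hr_def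
  set E := ∑' n : ℤ, |(n : ℝ)| * ‖c n‖ ^ 2 with hE
  -- By Parseval, r = 0 would make every coefficient vanish, hence a = 0, although a is invertible.
  have hr : 0 < r := by
    refine (norm_nonneg _).lt_of_ne fun hr0 => hpos.isUnit.ne_zero ?_
    have h0 : ∀ n, c n = 0 := fun n => by
      have := (hasSum_zero_iff_of_nonneg fun n => sq_nonneg ‖c n‖).mp (by
        rw [hr_def, ← hr0] at hN; simpa using hN)
      simpa using congrFun this n
    exact hac.unique (by simp [h0, hasSum_zero])
  have hτ0 : trace θ a = c 0 := by
    rw [← traceCLM_apply]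
    refine ((traceCLM θ).hasSum hac).unique ?_
    convert hasSum_ite_eq (0 : ℤ) (c 0) using 2 with n
    rw [map_smul, traceCLM_apply, trace_monomial]
    by_cases hn : n = 0 <;> simp [hn]
  obtain ⟨m, hm⟩ : ∃ m : ℝ, c 0 = m :=
    ⟨(c 0).re, Complex.ext rfl (by rw [← hτ0, trace_im_of_isSelfAdjoint hsa]; rfl)⟩
  -- The part of a with trace zero; its coefficients are those of a with the constant one removed.
  set g := a - (m : ℂ) • (1 : RotationAlgebra θ) with hg
  have hgsa : IsSelfAdjoint g :=
    hsa.sub (IsSelfAdjoint.smul (Complex.conj_ofReal m) (IsSelfAdjoint.one _))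
  set d : ℤ → ℂ := fun n => if n = 0 then 0 else c n with hd
  have hgd : HasSum (fun n : ℤ => d n • monomial θ n (s * n)) g := by
    have h1 := hac.sub (hasSum_ite_eq (0 : ℤ) ((m : ℂ) • (1 : RotationAlgebra θ)))
    refine h1.congr_fun fun n => ?_
    by_cases hn : n = 0 <;> simp [hd, hn, hm, monomial_zero]
  have hdc : ∀ n, ‖d n‖ ≤ ‖c n‖ := fun n => by
    simp only [hd]; split_ifs <;> simp
  have hdE : ∀ n : ℤ, |(n : ℝ)| * ‖d n‖ ^ 2 = |(n : ℝ)| * ‖c n‖ ^ 2 := fun n => by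
    by_cases hn : n = 0 <;> simp [hd, hn]
  have hX := hasSum_norm_sq_coeff (injective_line s) hgd
  set x := ‖gnsVector θ g‖ ^ 2 with hx
  have hmx : m ^ 2 + x = r ^ 2 := by
    have h1 := (hasSum_ite_eq (0 : ℤ) (m ^ 2)).add hX
    refine h1.unique (hN.congr_fun fun n => ?_)
    by_cases hn : n = 0 <;> simp [hd, hn, hm]
  have hds : Summable fun n => ‖d n‖ := Summable.of_nonneg_of_le (fun _ => norm_nonneg _) hdc hc
  have hdE' : Summable fun n : ℤ => |(n : ℝ)| * ‖d n‖ ^ 2 := by simpa only [hdE] using hc2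
  -- The spectral gap: |n| ≥ 1 at every frequency that occurs in g.
  have hxE : x ≤ E := by
    refine hasSum_le (fun n => ?_) hX hc2.hasSum
    by_cases hn : n = 0
    · simp [hd, hn]
    · rw [← hdE]
      refine le_mul_of_one_le_left (sq_nonneg _) ?_
      exact_mod_cast Int.one_le_abs hn
  have hT := (norm_trace_cube_le hgd hds).trans
    (tsum_cubic_le (fun n => norm_nonneg (d n)) (by simp [hd]) hds hX.summable hdE'
      (by positivity : 0 < 4 / 3 * r))
  simp only [hdE] at hT
  rw [hX.tsum_eq, ← hE] at hT
  have hg0 : trace θ g = 0 := by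
    rw [hg, map_sub, map_smul, trace_one, hτ0, hm]; simp
  have hg2 : trace θ (g * g) = x := by
    have := trace_star_mul_self g
    rwa [hgsa.star_eq] at this
  have ha3 : a ^ 3 = ((m ^ 3 : ℝ) : ℂ) • (1 : RotationAlgebra θ) + ((3 * m ^ 2 : ℝ) : ℂ) • g +
      ((3 * m : ℝ) : ℂ) • (g * g) + g * g * g := by
    have : a = (m : ℂ) • (1 : RotationAlgebra θ) + g := by rw [hg]; abel
    rw [this]
    simp only [pow_succ, pow_zero, one_mul, add_mul, mul_add, smul_mul_assoc, mul_smul_comm,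
      mul_one, smul_add, smul_smul]
    push_cast
    module
  have h3 : (trace θ (a ^ 3)).re ≤ r ^ 3 * Real.exp (2 * E / r ^ 2) := by
    rw [ha3, map_add, map_add, map_add, map_smul, map_smul, map_smul, trace_one, hg0, hg2]
    simp only [smul_eq_mul, mul_one, mul_zero, add_zero, ← Complex.ofReal_mul, Complex.add_re,
      Complex.ofReal_re]
    exact third_moment_le hr (sq_nonneg _) hxE hmx ((Complex.re_le_norm _).trans hT)
  have ha2 : (trace θ (a ^ 2)).re = r ^ 2 := by
    have := trace_star_mul_self a
    rw [hsa.star_eq, ← pow_two] at this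
    rw [this, Complex.ofReal_re]
  -- With this tangent point the cubic term contributes at most r², which cancels the -r² of the
  -- tangent line and leaves r² log r + 2E.
  have hl : 0 < r * Real.exp (2 * E / r ^ 2) := by positivity
  refine (trace_sq_mul_log_le hpos hl).trans ?_
  rw [ha2, Real.log_mul hr.ne' (Real.exp_pos _).ne', Real.log_exp]
  have h4 := mul_le_mul_of_nonneg_left h3 (inv_pos.mpr hl).le
  have h5 : (r * Real.exp (2 * E / r ^ 2))⁻¹ * (r ^ 3 * Real.exp (2 * E / r ^ 2)) = r ^ 2 := by
    field_simp
  have h6 : (Real.log r + 2 * E / r ^ 2 - 1) * r ^ 2 = r ^ 2 * Real.log r + 2 * E - r ^ 2 := by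
    field_simp
  linarith

end NCTorus

end

/-! ### The inequality with constant 1 + |s|. -/

theorem theorem3p2 (θ : ℝ) (hθ : Irrational θ) (s : ℤ) (hs : s ≠ 0)
    (a : NCTorus.RotationAlgebra θ) (ha : a ∈ NCTorus.smooth θ)
    (c : ℤ → ℂ) (hac : HasSum (fun n : ℤ => c n • NCTorus.monomial θ n (s * n)) a)
    (hpos : IsStrictlyPositive a) :
    Summable (fun n : ℤ => (1 + |(s : ℝ)|) * |(n : ℝ)| * ‖c n‖ ^ 2) ∧
    (NCTorus.trace θ (a ^ 2 * CFC.log a)).im = 0 ∧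
    (NCTorus.trace θ (a ^ 2)).im = 0 ∧
    (NCTorus.trace θ (a ^ 2 * CFC.log a)).re ≤
      ∑' n : ℤ, (1 + |(s : ℝ)|) * |(n : ℝ)| * ‖c n‖ ^ 2 +
        NCTorus.twoNorm a ^ 2 * Real.log (NCTorus.twoNorm a) ∧
    (NCTorus.trace θ (a ^ 2 * CFC.log a)).re ≤
      ∑' n : ℤ, (1 + |(s : ℝ)|) * |(n : ℝ)| * ‖c n‖ ^ 2 +
        (NCTorus.trace θ (a ^ 2)).re * Real.log (√(NCTorus.trace θ (a ^ 2)).re) := by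
  obtain ⟨C, hC⟩ := NCTorus.exists_norm_coeff_le ha hac
  have hc := NCTorus.summable_norm_of_bound hC
  have hc2 := NCTorus.summable_abs_mul_norm_sq_of_bound hC
  have hsa : IsSelfAdjoint a := hpos.isSelfAdjoint
  have ha2 := NCTorus.trace_star_mul_self a
  have h2 : NCTorus.twoNorm a = ‖NCTorus.gnsVector θ a‖ := by
    rw [NCTorus.twoNorm, ha2, Complex.ofReal_re, Real.sqrt_sq (norm_nonneg _)]
  rw [hsa.star_eq, ← pow_two] at ha2
  -- A nonzero integer has modulus at least 1, so the constant 2 is at most 1 + |s|.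
  have hs1 : (1 : ℝ) ≤ |(s : ℝ)| := by exact_mod_cast Int.one_le_abs hs
  have hE : 0 ≤ ∑' n : ℤ, |(n : ℝ)| * ‖c n‖ ^ 2 := tsum_nonneg fun n => by positivity
  have hmain : (NCTorus.trace θ (a ^ 2 * CFC.log a)).re ≤
      ∑' n : ℤ, (1 + |(s : ℝ)|) * |(n : ℝ)| * ‖c n‖ ^ 2 +
        ‖NCTorus.gnsVector θ a‖ ^ 2 * Real.log ‖NCTorus.gnsVector θ a‖ := by
    refine (NCTorus.trace_sq_mul_log_le_energy hac hc hc2 hpos).trans ?_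
    simp only [mul_assoc (1 + |(s : ℝ)|)]
    rw [tsum_mul_left]
    gcongr
    linarith
  refine ⟨?_, ?_, ?_, ?_, ?_⟩
  · simpa only [mul_assoc] using hc2.mul_left (1 + |(s : ℝ)|)
  · refine NCTorus.trace_im_of_isSelfAdjoint ?_
    rw [NCTorus.sq_mul_log_eq_cfc hpos]
    exact cfc_predicate _ a
  · rw [ha2, Complex.ofReal_im]
  · rwa [h2]
  · rwa [ha2, Complex.ofReal_re, Real.sqrt_sq (norm_nonneg _)]
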